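/- Let $k$ be a field and let $A$ be a DG-algebra over $k$ (a $\mathbb{Z}$-graded unital associative $k$-algebra with a differential $d$ of degree $1$ satisfying $d(xy)=d(x)y+(-1)^{|x|}x\,d(y)$ and $d^2=0$). A Maurer–Cartan element of $A$ is an element $a\in A^1$ with $d(a)+a^2=0$; the twisted DG-algebra ${}_aA_a$ is the graded algebra $A$ with the differential $d_a(x)=d(x)+[a,x]$, where $[a,x]=ax-(-1)^{|x|}xa$. A CDG-algebra is a graded algebra $B$ with a derivation $d_B$ of degree $1$ and an element $h_B\in B^2$ with $d_B(h_B)=0$ and $d_B^2(x)=[h_B,x]$; a morphism $B\to C$ of CDG-algebras is a pair $(f,c)$ of a morphism of graded algebras $f\colon B\to C$ and an element $c\in C^1$ with $f(d_Bx)=d_C(f(x))+[c,f(x)]$ and $f(h_B)=h_C+d_C(c)+c^2$, the composition is $(g,c')\circ(f,c)=(g\circ f,\,c'+g(c))$, and DG-algebras are regarded as CDG-algebras with $h=0$. For a DG-algebra $B$, let $\mathsf{Ho}(B)$ be the homotopy category of (left) DG-modules over $B$, let $\mathsf{CoAcycl}\subset\mathsf{Ho}(B)$ be the smallest full triangulated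 subcategory (closed under isomorphisms, shifts and cones) which contains the totalizations of the exact triples of DG-modules and is closed under infinite direct sums, and let the coderived category $\mathsf{D}^{co}(B)$ be the Verdier quotient $\mathsf{Ho}(B)/\mathsf{CoAcycl}$. Let $a,b\in A$ be Maurer–Cartan elements. Then: 1. $(\mathrm{id},-a)$ is an isomorphism of CDG-algebras $A\to{}_aA_a$, and $(\mathrm{id},a-b)$ is an isomorphism of CDG-algebras ${}_aA_a\to{}_bA_b$; 2. there is an equivalence of triangulated categories $\mathsf{D}^{co}({}_aA_a)\simeq\mathsf{D}^{co}({}_bA_b)$, that is, an equivalence of categories which commutes with the shifts and takes distinguished triangles to distinguished triangles. -/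

import Mathlib

open CategoryTheory

universe u v w

namespace DGCoderived

/-! ### Graded algebras, DG-algebras, Maurer–Cartan elements -/

section Algebra

variable {k : Type u} [Field k] {A : Type v} [Ring A] [Algebra k A]
  (𝒜 : ℤ → Submodule k A) [GradedAlgebra 𝒜]

/-- The linear map `A → A` that multiplies the elements of degree `p` by `(-1) ^ (n * p)`. -/
noncomputable def signLin (n : ℤ) : A →ₗ[k] A :=
  (DirectSum.toModule k ℤ A fun p => (n * p).negOnePow • (𝒜 p).subtype) ∘ₗ
    (DirectSum.decomposeLinearEquiv 𝒜).toLinearMap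

lemma signLin_of_mem (n : ℤ) {p : ℤ} {x : A} (hx : x ∈ 𝒜 p) :
    signLin 𝒜 n x = (n * p).negOnePow • x := by
  have h := DirectSum.decomposeLinearEquiv_apply_coe (R := k) 𝒜 p ⟨x, hx⟩
  simp only [signLin, LinearMap.comp_apply, LinearEquiv.coe_coe] at h ⊢
  rw [h, DirectSum.toModule_lof]
  rfl

/-- The automorphism of a graded algebra that multiplies the elements of degree `p` by
`(-1) ^ (n * p)`. -/
noncomputable def signAut (n : ℤ) : A →ₐ[k] A :=
  AlgHom.ofLinearMap (signLin 𝒜 n)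
    (by rw [signLin_of_mem 𝒜 n (SetLike.GradedOne.one_mem (A := 𝒜))]; simp)
    (by
      intro x y
      induction x using DirectSum.Decomposition.inductionOn 𝒜 with
      | zero => simp
      | add x x' hx hx' => simp only [add_mul, map_add, hx, hx']
      | @homogeneous p x =>
        induction y using DirectSum.Decomposition.inductionOn 𝒜 with
        | zero => simp
        | add y y' hy hy' => simp only [mul_add, map_add, hy, hy']
        | @homogeneous q y =>
          rw [signLin_of_mem 𝒜 n (SetLike.GradedMul.mul_mem x.2 y.2), signLin_of_mem 𝒜 n x.2,
            signLin_of_mem 𝒜 n y.2, mul_add, Int.negOnePow_add, smul_mul_smul_comm])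

lemma signAut_of_mem (n : ℤ) {p : ℤ} {x : A} (hx : x ∈ 𝒜 p) :
    signAut 𝒜 n x = (n * p).negOnePow • x := signLin_of_mem 𝒜 n hx

/-- The graded commutator `[c, -]` with an element `c` of degree `1`:
`[c, x] = c x - (-1) ^ |x| x c`. -/
noncomputable def bracketOne (c : A) : A →ₗ[k] A :=
  LinearMap.mulLeft k c - LinearMap.mulRight k c ∘ₗ signLin 𝒜 1

lemma bracketOne_of_mem (c : A) {p : ℤ} {x : A} (hx : x ∈ 𝒜 p) :
    bracketOne 𝒜 c x = c * x - p.negOnePow • (x * c) := by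
  simp [bracketOne, signLin_of_mem 𝒜 1 hx]

/-- A structure of DG-algebra on a `ℤ`-graded `k`-algebra: a differential of degree `1` which is
a (graded) derivation and has square zero. -/
structure DGStr where
  /-- The differential. -/
  d : A →ₗ[k] A
  d_mem : ∀ {p : ℤ} {x : A}, x ∈ 𝒜 p → d x ∈ 𝒜 (p + 1)
  leibniz : ∀ {p : ℤ} {x : A} (y : A), x ∈ 𝒜 p → d (x * y) = d x * y + p.negOnePow • (x * d y)
  d_d : ∀ x, d (d x) = 0

variable {𝒜}

/-- Maurer–Cartan elements: elements `a` of degree `1` with `d a + a ^ 2 = 0`. -/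
def DGStr.IsMaurerCartan (D : DGStr 𝒜) (a : A) : Prop :=
  a ∈ 𝒜 1 ∧ D.d a + a * a = 0

lemma bracketOne_mem {c : A} (hc : c ∈ 𝒜 1) {p : ℤ} {x : A} (hx : x ∈ 𝒜 p) :
    bracketOne 𝒜 c x ∈ 𝒜 (p + 1) := by
  rw [bracketOne_of_mem 𝒜 c hx]
  refine Submodule.sub_mem _ ?_ ?_
  · rw [add_comm]; exact SetLike.GradedMul.mul_mem hc hx
  · rw [Units.smul_def]
    exact zsmul_mem (SetLike.GradedMul.mul_mem hx hc) _

/-- The twisted DG-algebra `ₐAₐ`: the same graded algebra, with the differential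
`x ↦ d x + [a, x]`. -/
noncomputable def DGStr.twist (D : DGStr 𝒜) (a : A) (ha : D.IsMaurerCartan a) : DGStr 𝒜 where
  d := D.d + bracketOne 𝒜 a
  d_mem hx := Submodule.add_mem _ (D.d_mem hx) (bracketOne_mem ha.1 hx)
  leibniz {p x} y hx := by
    induction y using DirectSum.Decomposition.inductionOn 𝒜 with
    | zero => simp
    | add y y' hy hy' => simp only [mul_add, map_add, hy, hy', smul_add]; abel
    | @homogeneous q y =>
      simp only [LinearMap.add_apply]
      rw [D.leibniz _ hx, bracketOne_of_mem 𝒜 a (SetLike.GradedMul.mul_mem hx y.2),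
        bracketOne_of_mem 𝒜 a hx, bracketOne_of_mem 𝒜 a y.2, Int.negOnePow_add]
      simp only [mul_add, add_mul, mul_sub, sub_mul, smul_add, smul_sub, Units.smul_def,
        mul_smul_comm, smul_mul_assoc, smul_smul, mul_assoc, Units.val_mul]
      abel
  d_d x := by
    induction x using DirectSum.Decomposition.inductionOn 𝒜 with
    | zero => simp
    | add y y' hy hy' => simp only [map_add, hy, hy', add_zero]
    | @homogeneous p x =>
      have h1 : D.d a = -(a * a) := eq_neg_of_add_eq_zero_left ha.2
      have hs : ∀ z : A, p.negOnePow • p.negOnePow • z = z := fun z => by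
        rw [smul_smul, ← Int.negOnePow_add, ← two_mul, Int.negOnePow_two_mul, one_smul]
      simp only [LinearMap.add_apply, map_add]
      rw [bracketOne_of_mem 𝒜 a (D.d_mem x.2), bracketOne_of_mem 𝒜 a
        (bracketOne_mem ha.1 x.2), bracketOne_of_mem 𝒜 a x.2, D.d_d]
      have hL : D.d (a * (x : A) - p.negOnePow • ((x : A) * a)) =
          -(a * a) * x - a * D.d x - p.negOnePow • (D.d x * a) + x * (a * a) := by
        rw [map_sub, D.leibniz _ ha.1, h1, Units.smul_def, Units.smul_def, map_zsmul,
          D.leibniz _ x.2, h1, Int.negOnePow_one, ← Units.smul_def, ← Units.smul_def,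
          smul_add, hs]
        simp
        abel
      rw [hL, Int.negOnePow_succ]
      simp only [mul_sub, sub_mul, Units.neg_smul, smul_sub, smul_mul_assoc, mul_smul_comm,
        hs, mul_assoc]
      noncomm_ring

end Algebra

/-! ### CDG-algebras -/

section CDG

variable {k : Type u} [Field k]

/-- A structure of CDG-algebra (curved DG-algebra) on a `ℤ`-graded `k`-algebra: a derivation `d`
of degree `1` and a closed curvature element `h` of degree `2` with `d (d x) = [h, x]`.
(As `h` has even degree, `[h, x] = h x - x h`.) -/
structure CDGStr {A : Type v} [Ring A] [Algebra k A] (𝒜 : ℤ → Submodule k A)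
    [GradedAlgebra 𝒜] where
  /-- The derivation. -/
  d : A →ₗ[k] A
  d_mem : ∀ {p : ℤ} {x : A}, x ∈ 𝒜 p → d x ∈ 𝒜 (p + 1)
  leibniz : ∀ {p : ℤ} {x : A} (y : A), x ∈ 𝒜 p → d (x * y) = d x * y + p.negOnePow • (x * d y)
  /-- The curvature. -/
  h : A
  h_mem : h ∈ 𝒜 2
  d_h : d h = 0
  d_d : ∀ x, d (d x) = h * x - x * h

/-- A DG-algebra is a CDG-algebra with zero curvature. -/
def DGStr.toCDG {A : Type v} [Ring A] [Algebra k A] {𝒜 : ℤ → Submodule k A} [GradedAlgebra 𝒜]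
    (D : DGStr 𝒜) : CDGStr 𝒜 where
  d := D.d
  d_mem := D.d_mem
  leibniz := D.leibniz
  h := 0
  h_mem := Submodule.zero_mem _
  d_h := map_zero _
  d_d x := by simp [D.d_d]

variable {A B C : Type v} [Ring A] [Algebra k A] [Ring B] [Algebra k B] [Ring C] [Algebra k C]
  {𝒜 : ℤ → Submodule k A} [GradedAlgebra 𝒜] {ℬ : ℤ → Submodule k B} [GradedAlgebra ℬ]
  {𝒞 : ℤ → Submodule k C} [GradedAlgebra 𝒞]

/-- A morphism of CDG-algebras: a pair `(f, c)` of a morphism `f` of graded algebras and an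
element `c` of degree `1` of the target (the change of curvature), with
`f (d x) = d (f x) + [c, f x]` and `f h = h + d c + c ^ 2`. -/
@[ext]
structure CDGHom (S : CDGStr 𝒜) (T : CDGStr ℬ) where
  /-- The underlying morphism of algebras. -/
  f : A →ₐ[k] B
  /-- The change of curvature. -/
  c : B
  f_mem : ∀ {p : ℤ} {x : A}, x ∈ 𝒜 p → f x ∈ ℬ p
  c_mem : c ∈ ℬ 1
  f_d : ∀ {p : ℤ} {x : A}, x ∈ 𝒜 p → f (S.d x) = T.d (f x) + (c * f x - p.negOnePow • (f x * c))
  f_h : f S.h = T.h + T.d c + c * c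

/-- The identity `(id, 0)`. -/
def CDGHom.id (S : CDGStr 𝒜) : CDGHom S S where
  f := AlgHom.id k A
  c := 0
  f_mem h := h
  c_mem := Submodule.zero_mem _
  f_d _ := by simp
  f_h := by simp

/-- The composition `(g, c) ∘ (f, b) = (g ∘ f, c + g b)`. -/
def CDGHom.comp {S : CDGStr 𝒜} {T : CDGStr ℬ} {U : CDGStr 𝒞} (ψ : CDGHom T U)
    (φ : CDGHom S T) : CDGHom S U where
  f := ψ.f.comp φ.f
  c := ψ.c + ψ.f φ.c
  f_mem h := ψ.f_mem (φ.f_mem h)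
  c_mem := Submodule.add_mem _ ψ.c_mem (ψ.f_mem φ.c_mem)
  f_d {p x} hx := by
    simp only [AlgHom.comp_apply, φ.f_d hx, map_add, map_sub, map_mul, ψ.f_d (φ.f_mem hx),
      Units.smul_def, map_zsmul, mul_add, add_mul, smul_add]
    abel
  f_h := by
    simp only [AlgHom.comp_apply, φ.f_h, map_add, map_mul, ψ.f_h, ψ.f_d φ.c_mem,
      Int.negOnePow_one, Units.neg_smul, one_smul, mul_add, add_mul]
    abel

/-- Isomorphisms of CDG-algebras: morphisms with a two-sided inverse. -/
def CDGHom.IsIso {S : CDGStr 𝒜} {T : CDGStr ℬ} (φ : CDGHom S T) : Prop :=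
  ∃ ψ : CDGHom T S, ψ.comp φ = CDGHom.id S ∧ φ.comp ψ = CDGHom.id T

end CDG

/-! ### Facts on internal gradings -/

section Grading

variable {k : Type u} [Field k]

/-- If the linear maps `p t` into graded modules are jointly injective and compatible with the
gradings, and the images of the linear maps `i t`, also compatible with the gradings, span the
module, then the module is the direct sum of its graded pieces. -/
lemma isInternal_of_maps {T : Type*} {N : T → Type*} [∀ t, AddCommGroup (N t)]
    [∀ t, Module k (N t)] {𝒩 : ∀ t, ℤ → Submodule k (N t)}
    (h : ∀ t, DirectSum.IsInternal (𝒩 t))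
    {M : Type*} [AddCommGroup M] [Module k M] {ℳ : ℤ → Submodule k M}
    (p : ∀ t, M →ₗ[k] N t) (hp : ∀ m, (∀ t, p t m = 0) → m = 0)
    (hpm : ∀ t n m, m ∈ ℳ n → p t m ∈ 𝒩 t n)
    (i : ∀ t, N t →ₗ[k] M) (hi : ⨆ t, LinearMap.range (i t) = ⊤)
    (him : ∀ t n m, m ∈ 𝒩 t n → i t m ∈ ℳ n) : DirectSum.IsInternal ℳ := by
  rw [DirectSum.isInternal_submodule_iff_iSupIndep_and_iSup_eq_top]
  constructor
  · intro n
    rw [Submodule.disjoint_def]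
    intro m hm hm'
    refine hp m fun t => ?_
    have hd := ((DirectSum.isInternal_submodule_iff_iSupIndep_and_iSup_eq_top _).1 (h t)).1 n
    rw [Submodule.disjoint_def] at hd
    refine hd _ (hpm t n m hm) ?_
    have hle : (⨆ j, ⨆ (_ : j ≠ n), ℳ j) ≤ (⨆ j, ⨆ (_ : j ≠ n), 𝒩 t j).comap (p t) :=
      iSup₂_le fun j hj x hx =>
        Submodule.mem_iSup_of_mem j (Submodule.mem_iSup_of_mem hj (hpm t j x hx))
    exact hle hm'
  · rw [eq_top_iff, ← hi]
    refine iSup_le fun t => ?_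
    have ht := ((DirectSum.isInternal_submodule_iff_iSupIndep_and_iSup_eq_top _).1 (h t)).2
    rw [LinearMap.range_eq_map, ← ht, Submodule.map_iSup]
    refine iSup_le fun n => ?_
    rw [Submodule.map_le_iff_le_comap]
    exact fun x hx => Submodule.mem_iSup_of_mem n (him t n x hx)

lemma isInternal_shift {M : Type*} [AddCommGroup M] [Module k M] {ℳ : ℤ → Submodule k M}
    (h : DirectSum.IsInternal ℳ) (n : ℤ) : DirectSum.IsInternal fun i => ℳ (i + n) := by
  rw [DirectSum.isInternal_submodule_iff_iSupIndep_and_iSup_eq_top] at h ⊢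
  exact ⟨h.1.comp (add_left_injective n), (Equiv.addRight n).iSup_comp.trans h.2⟩

lemma isInternal_prod {M N : Type w} [AddCommGroup M] [Module k M] [AddCommGroup N] [Module k N]
    {ℳ : ℤ → Submodule k M} {𝒩 : ℤ → Submodule k N}
    (hM : DirectSum.IsInternal ℳ) (hN : DirectSum.IsInternal 𝒩) :
    DirectSum.IsInternal fun i => (ℳ i).prod (𝒩 i) := by
  rw [DirectSum.isInternal_submodule_iff_iSupIndep_and_iSup_eq_top] at *
  constructor
  · intro n
    rw [Submodule.disjoint_def]
    rintro ⟨x, y⟩ hm hm'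
    have h1 := hM.1 n
    have h2 := hN.1 n
    rw [Submodule.disjoint_def] at h1 h2
    have hle1 : (⨆ j, ⨆ (_ : j ≠ n), (ℳ j).prod (𝒩 j)) ≤
        (⨆ j, ⨆ (_ : j ≠ n), ℳ j).comap (LinearMap.fst k M N) :=
      iSup₂_le fun j hj x hx =>
        Submodule.mem_iSup_of_mem j (Submodule.mem_iSup_of_mem hj hx.1)
    have hle2 : (⨆ j, ⨆ (_ : j ≠ n), (ℳ j).prod (𝒩 j)) ≤
        (⨆ j, ⨆ (_ : j ≠ n), 𝒩 j).comap (LinearMap.snd k M N) :=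
      iSup₂_le fun j hj x hx =>
        Submodule.mem_iSup_of_mem j (Submodule.mem_iSup_of_mem hj hx.2)
    exact Prod.ext (h1 x hm.1 (hle1 hm')) (h2 y hm.2 (hle2 hm'))
  · rw [eq_top_iff]
    rintro ⟨x, y⟩ -
    have h1 : (⨆ j, ℳ j) ≤ (⨆ j, (ℳ j).prod (𝒩 j)).comap (LinearMap.inl k M N) :=
      iSup_le fun j _ hx => Submodule.mem_iSup_of_mem j ⟨hx, Submodule.zero_mem _⟩
    have h2 : (⨆ j, 𝒩 j) ≤ (⨆ j, (ℳ j).prod (𝒩 j)).comap (LinearMap.inr k M N) :=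
      iSup_le fun j _ hx => Submodule.mem_iSup_of_mem j ⟨Submodule.zero_mem _, hx⟩
    rw [hM.2] at h1
    rw [hN.2] at h2
    have h3 := h1 (Submodule.mem_top (R := k) (x := x))
    have h4 := h2 (Submodule.mem_top (R := k) (x := y))
    rw [Submodule.mem_comap] at h3 h4
    simpa using Submodule.add_mem _ h3 h4

end Grading

/-! ### DG-modules -/

section Modules

set_option linter.unusedSectionVars false

variable {k : Type u} [Field k] {A : Type v} [Ring A] [Algebra k A]
  {𝒜 : ℤ → Submodule k A} [GradedAlgebra 𝒜]

/-- (Left) DG-modules over a DG-algebra: `ℤ`-graded `k`-modules with a graded (unital) action of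
the algebra and a differential of degree `1` and square zero which satisfies the Leibniz rule. -/
structure DGMod (D : DGStr 𝒜) where
  /-- The underlying vector space (the direct sum of the components). -/
  carrier : Type w
  [addCommGroup : AddCommGroup carrier]
  [module : Module k carrier]
  /-- The homogeneous components. -/
  gr : ℤ → Submodule k carrier
  isInternal : DirectSum.IsInternal gr
  /-- The action of the algebra. -/
  act : A →ₐ[k] Module.End k carrier
  act_mem : ∀ {p q : ℤ} {x : A} {m : carrier}, x ∈ 𝒜 p → m ∈ gr q → act x m ∈ gr (p + q)
  /-- The differential. -/
  d : carrier →ₗ[k] carrier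
  d_mem : ∀ {q : ℤ} {m : carrier}, m ∈ gr q → d m ∈ gr (q + 1)
  d_d : ∀ m, d (d m) = 0
  leibniz : ∀ {p : ℤ} {x : A} (m : carrier), x ∈ 𝒜 p →
    d (act x m) = act (D.d x) m + p.negOnePow • act x (d m)

namespace DGMod

attribute [instance] addCommGroup module

variable {D : DGStr 𝒜}

/-- Morphisms of DG-modules: the closed morphisms of degree `0`. -/
@[ext]
structure Hom (M N : DGMod.{u, v, w} D) where
  /-- The underlying linear map. -/
  lin : M.carrier →ₗ[k] N.carrier
  lin_mem : ∀ {q : ℤ} {m : M.carrier}, m ∈ M.gr q → lin m ∈ N.gr q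
  lin_act : ∀ (x : A) (m : M.carrier), lin (M.act x m) = N.act x (lin m)
  lin_d : ∀ m : M.carrier, lin (M.d m) = N.d (lin m)

/-- The category of DG-modules and closed morphisms of degree `0`. -/
instance : Category (DGMod.{u, v, w} D) where
  Hom M N := Hom M N
  id M := ⟨LinearMap.id, fun h => h, fun _ _ => rfl, fun _ => rfl⟩
  comp f g := ⟨g.lin ∘ₗ f.lin, fun h => g.lin_mem (f.lin_mem h),
    fun x m => by simp [f.lin_act, g.lin_act], fun m => by simp [f.lin_d, g.lin_d]⟩

@[ext]
lemma hom_ext {M N : DGMod.{u, v, w} D} {f g : M ⟶ N} (h : ∀ m, f.lin m = g.lin m) : f = g :=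
  Hom.ext (LinearMap.ext h)

@[simp] lemma id_lin (M : DGMod.{u, v, w} D) (m : M.carrier) : Hom.lin (𝟙 M) m = m := rfl

@[simp] lemma comp_lin {M N P : DGMod.{u, v, w} D} (f : M ⟶ N) (g : N ⟶ P) (m : M.carrier) :
    (f ≫ g).lin m = g.lin (f.lin m) := rfl

lemma smul_smul_negOnePow {M : Type*} [AddCommGroup M] (p : ℤ) (m : M) :
    p.negOnePow • p.negOnePow • m = m := by
  rw [smul_smul, ← Int.negOnePow_add, ← two_mul, Int.negOnePow_two_mul, one_smul]

lemma map_negOnePow_smul {M N : Type*} [AddCommGroup M] [Module k M] [AddCommGroup N]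
    [Module k N] (f : M →ₗ[k] N) (p : ℤ) (m : M) :
    f (p.negOnePow • m) = p.negOnePow • f m := by
  rw [Units.smul_def, Units.smul_def, map_zsmul]

lemma act_negOnePow_smul (M : DGMod.{u, v, w} D) (p : ℤ) (x : A) (m : M.carrier) :
    M.act (p.negOnePow • x) m = p.negOnePow • M.act x m := by
  rw [Units.smul_def, Units.smul_def, map_zsmul, LinearMap.smul_apply]

lemma negOnePow_smul_mem {M : Type*} [AddCommGroup M] [Module k M] (S : Submodule k M) (p : ℤ)
    {m : M} (hm : m ∈ S) : p.negOnePow • m ∈ S := by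
  rw [Units.smul_def]; exact zsmul_mem hm _

/-! #### Shift -/

/-- The shift `M[n]`: `M[n]^i = M^{i+n}`, the differential is multiplied by `(-1) ^ n`, and a
homogeneous element `x` acts on `M[n]` as `(-1) ^ (n * |x|) x`. -/
noncomputable def shift (M : DGMod.{u, v, w} D) (n : ℤ) : DGMod.{u, v, w} D where
  carrier := M.carrier
  gr i := M.gr (i + n)
  isInternal := isInternal_shift M.isInternal n
  act := M.act.comp (signAut 𝒜 n)
  act_mem {p q x m} hx hm := by
    rw [AlgHom.comp_apply, signAut_of_mem 𝒜 n hx, act_negOnePow_smul, add_assoc]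
    exact negOnePow_smul_mem _ _ (M.act_mem hx hm)
  d := n.negOnePow • M.d
  d_mem {q m} hm := by
    rw [add_right_comm]
    exact negOnePow_smul_mem _ _ (M.d_mem hm)
  d_d m := by
    simp only [LinearMap.smul_apply, map_negOnePow_smul, M.d_d, smul_zero]
  leibniz {p x} m hx := by
    simp only [LinearMap.smul_apply, AlgHom.comp_apply, signAut_of_mem 𝒜 n hx,
      signAut_of_mem 𝒜 n (D.d_mem hx), act_negOnePow_smul, map_negOnePow_smul, M.leibniz m hx,
      smul_add, smul_smul, ← Int.negOnePow_add]
    congr 3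
    · ring_nf
    · ring_nf

/-- The morphism `M[n] ⟶ N[n]` with the same underlying map as `f : M ⟶ N`. -/
noncomputable def shiftMap {M N : DGMod.{u, v, w} D} (f : M ⟶ N) (n : ℤ) :
    M.shift n ⟶ N.shift n where
  lin := f.lin
  lin_mem h := f.lin_mem h
  lin_act _ m := f.lin_act _ m
  lin_d m := (map_negOnePow_smul f.lin n (M.d m)).trans
    (congrArg (fun y : N.carrier => n.negOnePow • y) (f.lin_d m))

/-- The shift functor. -/
noncomputable def shiftFun (D : DGStr 𝒜) (n : ℤ) : DGMod.{u, v, w} D ⥤ DGMod.{u, v, w} D where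
  obj M := M.shift n
  map f := shiftMap f n

/-- A bijective linear map compatible with all structures is an isomorphism of DG-modules. -/
def isoMk {M N : DGMod.{u, v, w} D} (e : M.carrier ≃ₗ[k] N.carrier)
    (h : ∀ q m, m ∈ M.gr q ↔ e m ∈ N.gr q)
    (ha : ∀ x m, e (M.act x m) = N.act x (e m))
    (hd : ∀ m, e (M.d m) = N.d (e m)) : M ≅ N where
  hom := ⟨e.toLinearMap, fun {q m} hm => (h q m).1 hm, ha, hd⟩
  inv := ⟨e.symm.toLinearMap, fun {q m} hm => (h q _).2 (by simpa using hm),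
    fun x m => e.injective (by simp [ha]), fun m => e.injective (by simp [hd])⟩
  hom_inv_id := by ext m; exact e.symm_apply_apply m
  inv_hom_id := by ext m; exact e.apply_symm_apply m

lemma signAut_zero (x : A) : signAut 𝒜 0 x = x := by
  induction x using DirectSum.Decomposition.inductionOn 𝒜 with
  | zero => simp
  | add y y' hy hy' => simp only [map_add, hy, hy']
  | @homogeneous p x => simp [signAut_of_mem 𝒜 0 x.2]

lemma signAut_add (n m : ℤ) (x : A) : signAut 𝒜 (n + m) x = signAut 𝒜 n (signAut 𝒜 m x) := by
  induction x using DirectSum.Decomposition.inductionOn 𝒜 with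
  | zero => simp
  | add y y' hy hy' => simp only [map_add, hy, hy']
  | @homogeneous p x =>
    rw [signAut_of_mem 𝒜 m x.2, Units.smul_def, map_zsmul, ← Units.smul_def,
      signAut_of_mem 𝒜 n x.2, signAut_of_mem 𝒜 _ x.2, smul_smul, ← Int.negOnePow_add]
    congr 2
    ring

/-- The isomorphism `M[0] ≅ M` given by the identity map. -/
noncomputable def shiftZeroIso (M : DGMod.{u, v, w} D) : M.shift 0 ≅ M :=
  isoMk (M := M.shift 0) (N := M) (LinearEquiv.refl k M.carrier)
    (fun q m => by
      change m ∈ M.gr (q + 0) ↔ m ∈ M.gr q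
      rw [add_zero])
    (fun x m => congrArg (fun y : A => M.act y m) (signAut_zero x))
    (fun m => one_smul ℤˣ (M.d m))

/-- The isomorphism `M[n + m] ≅ M[n][m]` given by the identity map. -/
noncomputable def shiftAddIso (M : DGMod.{u, v, w} D) (n m : ℤ) :
    M.shift (n + m) ≅ (M.shift n).shift m :=
  isoMk (M := M.shift (n + m)) (N := (M.shift n).shift m) (LinearEquiv.refl k M.carrier)
    (fun q y => by
      change y ∈ M.gr (q + (n + m)) ↔ y ∈ M.gr (q + m + n)
      rw [add_comm n m, add_assoc])
    (fun x y => congrArg (fun z : A => M.act z y) (signAut_add n m x))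
    (fun y => by
      change (n + m).negOnePow • M.d y = m.negOnePow • n.negOnePow • M.d y
      rw [smul_smul, ← Int.negOnePow_add, add_comm])

lemma eqToHom_shift_lin (M : DGMod.{u, v, w} D) {n m : ℤ} (h : n = m)
    (h' : M.shift n = M.shift m) (y : M.carrier) :
    Hom.lin (M := M.shift n) (N := M.shift m) (eqToHom h') y = y := by
  subst h
  rfl

noncomputable instance : HasShift (DGMod.{u, v, w} D) ℤ :=
  hasShiftMk _ _
    { F := shiftFun D
      zero := NatIso.ofComponents shiftZeroIso (fun _ => rfl)
      add := fun n m => NatIso.ofComponents (fun M => M.shiftAddIso n m) (fun _ => rfl)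
      assoc_hom_app := fun m₁ m₂ m₃ X => by
        ext y
        exact (eqToHom_shift_lin X (add_assoc m₁ m₂ m₃) _ y).symm
      zero_add_hom_app := fun n X => by
        ext y
        exact (eqToHom_shift_lin X (zero_add n) _ y).symm
      add_zero_hom_app := fun n X => by
        ext y
        exact (eqToHom_shift_lin X (add_zero n) _ y).symm }

/-! #### Homotopies -/

/-- Two morphisms `f` and `g` are homotopic if `f - g = d s + s d` for a map `s` of degree `-1`
with `s (x m) = (-1) ^ |x| x s(m)`. -/
def Homotopic {M N : DGMod.{u, v, w} D} (f g : M ⟶ N) : Prop :=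
  ∃ s : M.carrier →ₗ[k] N.carrier,
    (∀ {q : ℤ} {m : M.carrier}, m ∈ M.gr q → s m ∈ N.gr (q - 1)) ∧
    (∀ {p : ℤ} {x : A} (m : M.carrier), x ∈ 𝒜 p →
      s (M.act x m) = p.negOnePow • N.act x (s m)) ∧
    ∀ m, f.lin m - g.lin m = N.d (s m) + s (M.d m)

/-- The homotopy relation on the morphisms of the category of DG-modules. -/
def homotopyRel (D : DGStr 𝒜) : HomRel (DGMod.{u, v, w} D) := fun _ _ f g => Homotopic f g

instance : Congruence (homotopyRel.{u, v, w} D) where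
  equivalence :=
    { refl := fun f => ⟨0, fun _ => Submodule.zero_mem _, fun _ _ => by simp, fun _ => by simp⟩
      symm := by
        rintro f g ⟨s, h1, h2, h3⟩
        refine ⟨-s, fun h => Submodule.neg_mem _ (h1 h), fun m hx => by simp [h2 m hx],
          fun m => ?_⟩
        rw [← neg_sub, h3]
        simp only [LinearMap.neg_apply, map_neg]
        abel
      trans := by
        rintro f g h ⟨s, h1, h2, h3⟩ ⟨t, h1', h2', h3'⟩
        refine ⟨s + t, fun h => Submodule.add_mem _ (h1 h) (h1' h),
          fun m hx => by simp [h2 m hx, h2' m hx], fun m => ?_⟩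
        rw [← sub_add_sub_cancel _ (g.lin m), h3, h3']
        simp only [LinearMap.add_apply, map_add]
        abel }
  comp_left := by
    rintro M N P f g g' ⟨s, h1, h2, h3⟩
    exact ⟨s ∘ₗ f.lin, fun h => h1 (f.lin_mem h), fun m hx => by simp [f.lin_act, h2 _ hx],
      fun m => by simp [h3, f.lin_d]⟩
  comp_right := by
    rintro M N P f f' g ⟨s, h1, h2, h3⟩
    refine ⟨g.lin ∘ₗ s, fun h => g.lin_mem (h1 h), fun m hx => ?_, fun m => ?_⟩
    · simp only [LinearMap.comp_apply, h2 m hx, map_negOnePow_smul, g.lin_act]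
    · simp only [comp_lin, ← map_sub, h3, map_add, LinearMap.comp_apply, g.lin_d]

instance : HomRel.IsCompatibleWithShift (homotopyRel.{u, v, w} D) ℤ where
  condition n M N f g := by
    rintro ⟨s, h1, h2, h3⟩
    refine ⟨(n.negOnePow • s : M.carrier →ₗ[k] N.carrier), fun {q} (m : M.carrier) hm => ?_,
      fun {p x} (m : M.carrier) hx => ?_, fun (m : M.carrier) => ?_⟩
    · change n.negOnePow • s m ∈ N.gr (q - 1 + n)
      rw [sub_add_eq_add_sub]
      exact negOnePow_smul_mem _ _ (h1 hm)
    · change n.negOnePow • s (M.act (signAut 𝒜 n x) m) =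
        p.negOnePow • N.act (signAut 𝒜 n x) (n.negOnePow • s m)
      rw [signAut_of_mem 𝒜 n hx, act_negOnePow_smul, act_negOnePow_smul, map_negOnePow_smul,
        map_negOnePow_smul, h2 m hx]
      simp only [smul_smul]
      congr 1
      ac_rfl
    · change f.lin m - g.lin m = n.negOnePow • N.d (n.negOnePow • s m) +
        n.negOnePow • s (n.negOnePow • M.d m)
      rw [map_negOnePow_smul, map_negOnePow_smul, smul_smul_negOnePow, smul_smul_negOnePow]
      exact h3 m

/-! #### Cones, totalizations and direct sums -/

/-- The cone of a morphism `f : M ⟶ N`: `M[1] ⊕ N` with the differential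
`(m, n) ↦ (-d m, f m + d n)`. -/
noncomputable def cone {M N : DGMod.{u, v, w} D} (f : M ⟶ N) : DGMod.{u, v, w} D where
  carrier := M.carrier × N.carrier
  gr i := (M.gr (i + 1)).prod (N.gr i)
  isInternal := isInternal_prod (isInternal_shift M.isInternal 1) N.isInternal
  act := (LinearMap.prodMapAlgHom k M.carrier N.carrier).comp
    ((M.act.comp (signAut 𝒜 1)).prod N.act)
  act_mem {p q x m} hx hm := by
    refine ⟨?_, N.act_mem hx hm.2⟩
    change M.act (signAut 𝒜 1 x) m.1 ∈ _
    rw [signAut_of_mem 𝒜 1 hx, act_negOnePow_smul, add_assoc]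
    exact negOnePow_smul_mem _ _ (M.act_mem hx hm.1)
  d :=
    { toFun := fun m => (-M.d m.1, f.lin m.1 + N.d m.2)
      map_add' := fun m m' => by ext <;> simp <;> abel
      map_smul' := fun c m => by ext <;> simp }
  d_mem {q m} hm :=
    ⟨Submodule.neg_mem _ (M.d_mem hm.1), Submodule.add_mem _ (f.lin_mem hm.1) (N.d_mem hm.2)⟩
  d_d m := by
    ext
    · simp [M.d_d]
    · simp [N.d_d, f.lin_d]
  leibniz {p x} m hx := by
    have h1 := signAut_of_mem 𝒜 1 hx
    have h2 := signAut_of_mem 𝒜 1 (D.d_mem hx)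
    rw [one_mul] at h1 h2
    ext
    · change -M.d (M.act (signAut 𝒜 1 x) m.1) = M.act (signAut 𝒜 1 (D.d x)) m.1 +
        p.negOnePow • M.act (signAut 𝒜 1 x) (-M.d m.1)
      rw [h1, h2]
      simp only [act_negOnePow_smul, map_negOnePow_smul, M.leibniz _ hx, map_neg, smul_neg,
        smul_add, smul_smul_negOnePow, Int.negOnePow_succ, Units.neg_smul, neg_add,
        LinearMap.neg_apply]
    · change f.lin (M.act (signAut 𝒜 1 x) m.1) + N.d (N.act x m.2) = N.act (D.d x) m.2 +
        p.negOnePow • N.act x (f.lin m.1 + N.d m.2)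
      rw [h1]
      simp only [act_negOnePow_smul, map_negOnePow_smul, N.leibniz _ hx, map_add, f.lin_act,
        smul_add]
      abel

/-- The inclusion of the target in the cone. -/
noncomputable def coneInr {M N : DGMod.{u, v, w} D} (f : M ⟶ N) : N ⟶ cone f where
  lin := LinearMap.inr k M.carrier N.carrier
  lin_mem hm := ⟨Submodule.zero_mem _, hm⟩
  lin_act x m := Prod.ext (map_zero (M.act (signAut 𝒜 1 x))).symm rfl
  lin_d m := by
    change ((0, N.d m) : M.carrier × N.carrier) = (-M.d 0, f.lin 0 + N.d m)
    simp

/-- The projection of the cone of `f : M ⟶ N` to `M[1]`. -/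
noncomputable def coneFst {M N : DGMod.{u, v, w} D} (f : M ⟶ N) : cone f ⟶ M⟦(1 : ℤ)⟧ where
  lin := LinearMap.fst k M.carrier N.carrier
  lin_mem hm := hm.1
  lin_act x m := rfl
  lin_d m := by
    change -M.d m.1 = (1 : ℤ).negOnePow • M.d m.1
    simp

/-- The standard triangle `M ⟶ N ⟶ cone f ⟶ M[1]` of a morphism `f : M ⟶ N`. -/
noncomputable def coneTriangle {M N : DGMod.{u, v, w} D} (f : M ⟶ N) :
    Pretriangulated.Triangle (DGMod.{u, v, w} D) :=
  Pretriangulated.Triangle.mk f (coneInr f) (coneFst f)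

/-- Exact triples `0 → K → L → M → 0` of DG-modules. (Exactness of the underlying sequence of
spaces is the same as exactness in every degree.) -/
structure IsExactTriple {K L M : DGMod.{u, v, w} D} (f : K ⟶ L) (g : L ⟶ M) : Prop where
  injective : Function.Injective f.lin
  exact : Function.Exact f.lin g.lin
  surjective : Function.Surjective g.lin

lemma IsExactTriple.comp_eq_zero {K L M : DGMod.{u, v, w} D} {f : K ⟶ L} {g : L ⟶ M}
    (h : IsExactTriple f g) (x : K.carrier) : g.lin (f.lin x) = 0 :=
  h.exact.apply_apply_eq_zero x

/-- The totalization of a complex `K ⟶ L ⟶ M` of DG-modules: `K[1] ⊕ L ⊕ M[-1]` with the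
differential `(x, y, z) ↦ (-d x, f x + d y, g y - d z)`. -/
noncomputable def totalization {K L M : DGMod.{u, v, w} D} (f : K ⟶ L) (g : L ⟶ M)
    (hfg : ∀ x, g.lin (f.lin x) = 0) : DGMod.{u, v, w} D where
  carrier := K.carrier × L.carrier × M.carrier
  gr i := (K.gr (i + 1)).prod ((L.gr i).prod (M.gr (i - 1)))
  isInternal := isInternal_prod (isInternal_shift K.isInternal 1)
    (isInternal_prod L.isInternal (isInternal_shift M.isInternal (-1)))
  act := (LinearMap.prodMapAlgHom k K.carrier (L.carrier × M.carrier)).comp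
    ((K.act.comp (signAut 𝒜 1)).prod ((LinearMap.prodMapAlgHom k L.carrier M.carrier).comp
      (L.act.prod (M.act.comp (signAut 𝒜 1)))))
  act_mem {p q x m} hx hm := by
    have h1 := signAut_of_mem 𝒜 1 hx
    refine ⟨?_, L.act_mem hx hm.2.1, ?_⟩
    · change K.act (signAut 𝒜 1 x) m.1 ∈ _
      rw [h1, act_negOnePow_smul, add_assoc]
      exact negOnePow_smul_mem _ _ (K.act_mem hx hm.1)
    · change M.act (signAut 𝒜 1 x) m.2.2 ∈ _
      rw [h1, act_negOnePow_smul, add_sub_assoc]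
      exact negOnePow_smul_mem _ _ (M.act_mem hx hm.2.2)
  d :=
    { toFun := fun m => (-K.d m.1, f.lin m.1 + L.d m.2.1, g.lin m.2.1 - M.d m.2.2)
      map_add' := fun m m' => by ext <;> simp <;> abel
      map_smul' := fun c m => by ext <;> simp [smul_sub] }
  d_mem {q m} hm := by
    refine ⟨Submodule.neg_mem _ (K.d_mem hm.1),
      Submodule.add_mem _ (f.lin_mem hm.1) (L.d_mem hm.2.1), ?_⟩
    have h := M.d_mem hm.2.2
    rw [sub_add_cancel] at h
    change g.lin m.2.1 - M.d m.2.2 ∈ M.gr (q + 1 - 1)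
    rw [add_sub_cancel_right]
    exact Submodule.sub_mem _ (g.lin_mem hm.2.1) h
  d_d m := by
    ext
    · simp [K.d_d]
    · simp [L.d_d, f.lin_d]
    · simp [M.d_d, g.lin_d, hfg]
  leibniz {p x} m hx := by
    have h1 := signAut_of_mem 𝒜 1 hx
    have h2 := signAut_of_mem 𝒜 1 (D.d_mem hx)
    rw [one_mul] at h1 h2
    ext
    · change -K.d (K.act (signAut 𝒜 1 x) m.1) = K.act (signAut 𝒜 1 (D.d x)) m.1 +
        p.negOnePow • K.act (signAut 𝒜 1 x) (-K.d m.1)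
      rw [h1, h2]
      simp only [act_negOnePow_smul, map_negOnePow_smul, K.leibniz _ hx, map_neg, smul_neg,
        smul_add, smul_smul_negOnePow, Int.negOnePow_succ, Units.neg_smul, neg_add,
        LinearMap.neg_apply]
    · change f.lin (K.act (signAut 𝒜 1 x) m.1) + L.d (L.act x m.2.1) = L.act (D.d x) m.2.1 +
        p.negOnePow • L.act x (f.lin m.1 + L.d m.2.1)
      rw [h1]
      simp only [act_negOnePow_smul, map_negOnePow_smul, L.leibniz _ hx, map_add, f.lin_act,
        smul_add]
      abel
    · change g.lin (L.act x m.2.1) - M.d (M.act (signAut 𝒜 1 x) m.2.2) =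
        M.act (signAut 𝒜 1 (D.d x)) m.2.2 +
        p.negOnePow • M.act (signAut 𝒜 1 x) (g.lin m.2.1 - M.d m.2.2)
      rw [h1, h2]
      simp only [act_negOnePow_smul, map_negOnePow_smul, M.leibniz _ hx, map_sub, g.lin_act,
        smul_add, smul_sub, smul_smul_negOnePow, Int.negOnePow_succ, Units.neg_smul, map_neg,
        LinearMap.neg_apply]
      abel

/-- The direct sum of a family of DG-modules. -/
noncomputable def directSum {ι : Type w} (M : ι → DGMod.{u, v, w} D) : DGMod.{u, v, w} D where
  carrier := DirectSum ι fun i => (M i).carrier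
  gr n :=
    { carrier := {m | ∀ i, m i ∈ (M i).gr n}
      add_mem' := fun h h' i => Submodule.add_mem _ (h i) (h' i)
      zero_mem' := fun i => Submodule.zero_mem _
      smul_mem' := fun c _ h i => Submodule.smul_mem _ c (h i) }
  isInternal := by
    classical
    refine isInternal_of_maps (fun i => (M i).isInternal)
      (fun i => DirectSum.component k ι (fun i => (M i).carrier) i)
      (fun m hm => DFinsupp.ext hm) (fun i n m hm => hm i)
      (fun i => DirectSum.lof k ι (fun i => (M i).carrier) i) ?_ ?_
    · exact DFinsupp.iSup_range_lsingle
    · intro i n m hm j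
      by_cases h : i = j
      · subst h
        rw [DirectSum.lof_apply]
        exact hm
      · rw [DirectSum.lof_eq_of, DirectSum.of_eq_of_ne _ _ _ (Ne.symm h)]
        exact Submodule.zero_mem _
  act := AlgHom.ofLinearMap
    { toFun := fun x => DirectSum.lmap fun i => (M i).act x
      map_add' := fun x y => by
        ext; simp
      map_smul' := fun c x => by
        ext m i
        rw [DirectSum.lmap_apply, map_smul]
        rfl }
    (by ext; simp)
    (fun x y => by ext; simp)
  act_mem {p q x m} hx hm i := (M i).act_mem hx (hm i)
  d := DirectSum.lmap fun i => (M i).d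
  d_mem {q m} hm i := (M i).d_mem (hm i)
  d_d m := DFinsupp.ext fun i => (M i).d_d (m i)
  leibniz {p x} m hx := DFinsupp.ext fun i => (M i).leibniz (m i) hx

/-! #### The cone and the shift -/

/-- Multiplication by `(-1) ^ n`. -/
def signEquiv (k : Type u) [Field k] (M : Type*) [AddCommGroup M] [Module k M] (n : ℤ) :
    M ≃ₗ[k] M where
  toFun m := n.negOnePow • m
  invFun m := n.negOnePow • m
  map_add' := smul_add _
  map_smul' c m := map_negOnePow_smul (LinearMap.lsmul k M c) n m |>.symm
  left_inv := smul_smul_negOnePow n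
  right_inv := smul_smul_negOnePow n

/-- The cone of `f[n]` is isomorphic to the shift by `n` of the cone of `f`. -/
noncomputable def coneShiftIso {M N : DGMod.{u, v, w} D} (f : M ⟶ N) (n : ℤ) :
    cone (f⟦n⟧') ≅ (cone f)⟦n⟧ :=
  isoMk (M := cone (shiftMap f n)) (N := (cone f).shift n)
    ((signEquiv k M.carrier n).prodCongr (LinearEquiv.refl k N.carrier))
    (fun q (m : M.carrier × N.carrier) => by
      change m.1 ∈ M.gr (q + 1 + n) ∧ m.2 ∈ N.gr (q + n) ↔
        n.negOnePow • m.1 ∈ M.gr (q + n + 1) ∧ m.2 ∈ N.gr (q + n)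
      rw [add_right_comm q n 1]
      refine and_congr_left fun _ => ⟨negOnePow_smul_mem _ _, fun h => ?_⟩
      have h' := negOnePow_smul_mem _ n h
      rwa [smul_smul_negOnePow] at h')
    (fun x (m : M.carrier × N.carrier) => by
      refine Prod.ext ?_ rfl
      change n.negOnePow • M.act (signAut 𝒜 n (signAut 𝒜 1 x)) m.1 =
        M.act (signAut 𝒜 1 (signAut 𝒜 n x)) (n.negOnePow • m.1)
      rw [← signAut_add, ← signAut_add, add_comm n 1, map_negOnePow_smul])
    (fun (m : M.carrier × N.carrier) => by
      refine Prod.ext ?_ ?_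
      · change n.negOnePow • -(n.negOnePow • M.d m.1) =
          n.negOnePow • -(M.d (n.negOnePow • m.1))
        rw [map_negOnePow_smul]
      · change f.lin m.1 + n.negOnePow • N.d m.2 =
          n.negOnePow • (f.lin (n.negOnePow • m.1) + N.d m.2)
        rw [map_negOnePow_smul, smul_add, smul_smul_negOnePow])

end DGMod

/-! ### The homotopy category and the coderived category -/

variable (D : DGStr 𝒜)

/-- The homotopy category of DG-modules. -/
abbrev Ho : Type _ := Quotient (DGMod.homotopyRel.{u, v, w} D)

/-- The functor from the category of DG-modules to its homotopy category. -/
abbrev Ho.functor : DGMod.{u, v, w} D ⥤ Ho.{u, v, w} D :=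
  Quotient.functor (DGMod.homotopyRel.{u, v, w} D)

/-- The full triangulated subcategories of the homotopy category (full subcategories closed under
isomorphisms, shifts and cones) which contain the totalizations of the exact triples of DG-modules
and are closed under (infinite) direct sums. -/
structure IsAdmissible (P : ObjectProperty (Ho.{u, v, w} D)) : Prop where
  of_iso : ∀ {X Y : Ho.{u, v, w} D}, (X ≅ Y) → P X → P Y
  shift : ∀ (M : DGMod.{u, v, w} D) (n : ℤ), P ((Ho.functor D).obj M) →
    P ((Ho.functor D).obj (M⟦n⟧))
  cone : ∀ {M N : DGMod.{u, v, w} D} (f : M ⟶ N), P ((Ho.functor D).obj M) →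
    P ((Ho.functor D).obj N) → P ((Ho.functor D).obj (DGMod.cone f))
  directSum : ∀ {ι : Type w} (M : ι → DGMod.{u, v, w} D),
    (∀ i, P ((Ho.functor D).obj (M i))) → P ((Ho.functor D).obj (DGMod.directSum M))
  totalization : ∀ {K L M : DGMod.{u, v, w} D} {f : K ⟶ L} {g : L ⟶ M}
    (h : DGMod.IsExactTriple f g),
    P ((Ho.functor D).obj (DGMod.totalization f g h.comp_eq_zero))

/-- The coacyclic objects: the smallest full triangulated subcategory of the homotopy category
which contains the totalizations of the exact triples of DG-modules and is closed under
(infinite) direct sums. -/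
def CoAcycl : ObjectProperty (Ho.{u, v, w} D) :=
  fun X => ∀ P : ObjectProperty (Ho.{u, v, w} D), IsAdmissible D P → P X

lemma isAdmissible_coAcycl : IsAdmissible D (CoAcycl.{u, v, w} D) where
  of_iso e h P hP := hP.of_iso e (h P hP)
  shift M n h P hP := hP.shift M n (h P hP)
  cone f h h' P hP := hP.cone f (h P hP) (h' P hP)
  directSum M h P hP := hP.directSum M fun i => h i P hP
  totalization h _ hP := hP.totalization h

/-- The morphisms of the homotopy category whose cone is coacyclic. (Every morphism of the homotopy
category is the class of a morphism of DG-modules, whose cone is determined up to isomorphism.) -/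
def coAcyclW : MorphismProperty (Ho.{u, v, w} D) := fun _ _ f =>
  ∃ (M N : DGMod.{u, v, w} D) (g : M ⟶ N),
    Nonempty (Arrow.mk f ≅ Arrow.mk ((Ho.functor D).map g)) ∧
      CoAcycl D ((Ho.functor D).obj (DGMod.cone g))

lemma coAcyclW_of_iso {X Y X' Y' : Ho.{u, v, w} D} {f : X ⟶ Y} {f' : X' ⟶ Y'}
    (e : Arrow.mk f ≅ Arrow.mk f') (h : coAcyclW D f) : coAcyclW D f' := by
  obtain ⟨M, N, g, ⟨i⟩, hg⟩ := h
  exact ⟨M, N, g, ⟨e.symm ≪≫ i⟩, hg⟩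

lemma coAcyclW_shift {X Y : Ho.{u, v, w} D} {f : X ⟶ Y} (h : coAcyclW D f) (n : ℤ) :
    coAcyclW D (f⟦n⟧') := by
  obtain ⟨M, N, g, ⟨i⟩, hg⟩ := h
  refine ⟨_, _, g⟦n⟧', ⟨(shiftFunctor (Ho.{u, v, w} D) n).mapArrow.mapIso i ≪≫ ?_⟩, ?_⟩
  · exact Arrow.isoMk (((Ho.functor D).commShiftIso n).symm.app M)
      (((Ho.functor D).commShiftIso n).symm.app N)
      (((Ho.functor D).commShiftIso n).inv.naturality g).symm
  · exact (isAdmissible_coAcycl D).of_iso ((Ho.functor D).mapIso (DGMod.coneShiftIso g n).symm)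
      ((isAdmissible_coAcycl D).shift _ n hg)

instance : (coAcyclW.{u, v, w} D).IsCompatibleWithShift ℤ where
  condition n := by
    ext X Y f
    refine ⟨fun h => ?_, fun h => coAcyclW_shift D h n⟩
    exact coAcyclW_of_iso D (Arrow.isoMk ((shiftFunctorCompIsoId _ n (-n) (add_neg_cancel n)).app X)
      ((shiftFunctorCompIsoId _ n (-n) (add_neg_cancel n)).app Y)
      ((shiftFunctorCompIsoId (Ho.{u, v, w} D) n (-n) (add_neg_cancel n)).hom.naturality f).symm)
      (coAcyclW_shift D h (-n))

/-- The coderived category: the Verdier quotient of the homotopy category by the coacyclic objects,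
that is, its localization with respect to the morphisms whose cone is coacyclic. -/
abbrev Dco : Type _ := (coAcyclW.{u, v, w} D).Localization

/-- The functor from the category of DG-modules to the coderived category. -/
noncomputable abbrev Dco.functor : DGMod.{u, v, w} D ⥤ Dco.{u, v, w} D :=
  Ho.functor D ⋙ (coAcyclW.{u, v, w} D).Q

/-- The distinguished triangles of the coderived category: the triangles which are isomorphic to the
images of the standard triangles `M ⟶ N ⟶ cone f ⟶ M[1]`. -/
def Dco.distTriangles : Set (Pretriangulated.Triangle (Dco.{u, v, w} D)) :=
  {T | ∃ (M N : DGMod.{u, v, w} D) (f : M ⟶ N),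
    Nonempty (T ≅ (Dco.functor D).mapTriangle.obj (DGMod.coneTriangle f))}

end Modules

end DGCoderived

/-! A twist is undone by a twist. If `c` is a Maurer–Cartan element of `D` and `D'` has the
differential `d + [c, -]`, then `-c` is a Maurer–Cartan element of `D'` and leads back to `D`
(`IsTwist.symm`). The twists by `a` and by `b` are related in the same way, with `c = b - a`
(`IsTwist.twist_twist`). Both isomorphisms of CDG-algebras are thus instances of one morphism `(id,
-c)`, with inverse `(id, c)`.

A DG-module over `D` becomes a DG-module over `D'` when `d` is replaced by `d + c`: the
Maurer–Cartan equation gives `(d + c)² = 0`, and the commutator in the differential of `D'` gives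
the Leibniz rule. The underlying graded modules and linear maps do not change, so this is an
isomorphism of categories, up to identity maps, with the twist by `-c` as inverse. Since `c` has odd
degree, it acts on shifts with the same sign that the differential acquires, and it anticommutes
with contracting homotopies. Shifts, cones, totalizations, direct sums, exact triples and homotopies
are therefore preserved.

Hence twisting is an equivalence of homotopy categories, and it pulls admissible subcategories back
to admissible ones (`isAdmissible_inverseImage`). By minimality it preserves coacyclic objects, and
so does its inverse; it therefore descends to an equivalence of the localizations. A distinguished
triangle comes from a cone, and the cone is preserved already at the level of DG-modules. -/

namespace DGCoderived

/-! ### Twists by Maurer–Cartan elements and isomorphisms of CDG-algebras -/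

section Change

variable {k : Type u} [Field k] {A : Type v} [Ring A] [Algebra k A]
  {𝒜 : ℤ → Submodule k A} [GradedAlgebra 𝒜]

/-- The DG-algebra structure `D'` is obtained from `D` by adding `[c, -]` to the differential,
where `c` is a Maurer–Cartan element of `D`. -/
structure IsTwist (D D' : DGStr 𝒜) (c : A) : Prop where
  mem : c ∈ 𝒜 1
  maurerCartan : D.d c + c * c = 0
  d_eq : ∀ x, D'.d x = D.d x + bracketOne 𝒜 c x

lemma bracketOne_neg (c x : A) : bracketOne 𝒜 (-c) x = -bracketOne 𝒜 c x := by
  simp only [bracketOne, LinearMap.sub_apply, LinearMap.comp_apply, LinearMap.mulLeft_apply,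
    LinearMap.mulRight_apply]
  noncomm_ring

lemma bracketOne_add (b c x : A) :
    bracketOne 𝒜 (b + c) x = bracketOne 𝒜 b x + bracketOne 𝒜 c x := by
  simp only [bracketOne, LinearMap.sub_apply, LinearMap.comp_apply, LinearMap.mulLeft_apply,
    LinearMap.mulRight_apply]
  noncomm_ring

lemma bracketOne_of_mem_one (c : A) {x : A} (hx : x ∈ 𝒜 1) :
    bracketOne 𝒜 c x = c * x + x * c := by
  rw [bracketOne_of_mem 𝒜 c hx, Int.negOnePow_one, Units.neg_smul, one_smul, sub_neg_eq_add]

namespace IsTwist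

variable {D D' : DGStr 𝒜} {c : A}

/-- As `c` is odd, `[c, c] = 2c²`. So `d' c = -c² + 2c² = c²`, which is the Maurer–Cartan equation
for `-c`. -/
lemma symm (h : IsTwist D D' c) : IsTwist D' D (-c) where
  mem := Submodule.neg_mem _ h.mem
  maurerCartan := by
    have h1 : D.d c = -(c * c) := eq_neg_of_add_eq_zero_left h.maurerCartan
    rw [h.d_eq, map_neg, map_neg, h1, bracketOne_of_mem_one c h.mem]
    noncomm_ring
  d_eq x := by rw [h.d_eq, bracketOne_neg, add_neg_cancel_right]

/-- The twist by `a` is obtained by adding `[a, -]` to the differential. -/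
lemma of_twist (D : DGStr 𝒜) {a : A} (ha : D.IsMaurerCartan a) : IsTwist D (D.twist a ha) a :=
  ⟨ha.1, ha.2, fun _ => rfl⟩

/-- With `e = b - a`, one has `d e = a² - b²` and `ae + ea + e² = b² - a²`, and these cancel. This
relates the two twists directly, without passing through `D`. -/
lemma twist_twist (D : DGStr 𝒜) {a b : A} (ha : D.IsMaurerCartan a) (hb : D.IsMaurerCartan b) :
    IsTwist (D.twist a ha) (D.twist b hb) (b - a) where
  mem := Submodule.sub_mem _ hb.1 ha.1
  maurerCartan := by
    have h1 : D.d a = -(a * a) := eq_neg_of_add_eq_zero_left ha.2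
    have h2 : D.d b = -(b * b) := eq_neg_of_add_eq_zero_left hb.2
    rw [(of_twist D ha).d_eq, bracketOne_of_mem_one a (Submodule.sub_mem _ hb.1 ha.1), map_sub,
      h1, h2]
    noncomm_ring
  d_eq x := by
    rw [(of_twist D ha).d_eq, (of_twist D hb).d_eq, add_assoc, ← bracketOne_add,
      add_sub_cancel]

/-- The morphism of CDG-algebras `(id, -c)`. -/
def cdgHom (h : IsTwist D D' c) : CDGHom D.toCDG D'.toCDG where
  f := AlgHom.id k A
  c := -c
  f_mem hx := hx
  c_mem := Submodule.neg_mem _ h.mem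
  -- Both remaining conditions restate that `D` is the twist of `D'` by `-c`: the formula for `d`,
  -- and the Maurer–Cartan equation for `-c` in `D'`.
  f_d {p x} hx := by
    change D.d x = D'.d x + (-c * x - p.negOnePow • (x * -c))
    rw [← bracketOne_of_mem 𝒜 (-c) hx, h.symm.d_eq]
  f_h := by
    change (0 : A) = 0 + D'.d (-c) + -c * -c
    rw [zero_add, h.symm.maurerCartan]

/-- Changes of curvature add when the algebra maps are identities, and `-c + c = 0`. -/
lemma isIso_cdgHom (h : IsTwist D D' c) : h.cdgHom.IsIso :=
  ⟨h.symm.cdgHom, CDGHom.ext rfl (by simp [CDGHom.comp, CDGHom.id, cdgHom]),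
    CDGHom.ext rfl (by simp [CDGHom.comp, CDGHom.id, cdgHom])⟩

/-! ### Twisting DG-modules -/

/-- The DG-module over `D'` with the same action as `M` and the differential `m ↦ d m + c m`. -/
def mod (h : IsTwist D D' c) (M : DGMod.{u, v, w} D) : DGMod.{u, v, w} D' where
  carrier := M.carrier
  gr := M.gr
  isInternal := M.isInternal
  act := M.act
  act_mem := M.act_mem
  d := M.d + M.act c
  d_mem hm := Submodule.add_mem _ (M.d_mem hm) (by rw [add_comm]; exact M.act_mem h.mem hm)
  -- In `d² + dc + cd + c²` the Leibniz rule for the odd element `c` leaves the action of `d c +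
  -- c²`, which is zero.
  d_d m := by
    have h1 : D.d c = -(c * c) := eq_neg_of_add_eq_zero_left h.maurerCartan
    simp only [LinearMap.add_apply, map_add, M.d_d, M.leibniz _ h.mem, h1, map_neg, map_mul,
      Int.negOnePow_one, Units.neg_smul, one_smul, LinearMap.neg_apply, Module.End.mul_apply]
    abel
  -- The extra term is `c x m = [c, x] m + (-1) ^ p x c m`, and `[c, x]` is the change of the
  -- differential of the algebra.
  leibniz {p x} m hx := by
    simp only [LinearMap.add_apply, map_add, M.leibniz _ hx, h.d_eq, bracketOne_of_mem 𝒜 c hx,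
      map_sub, DGMod.act_negOnePow_smul, map_mul, Module.End.mul_apply, smul_add,
      LinearMap.sub_apply]
    abel

/-- The functor from DG-modules over `D` to DG-modules over `D'` which adds the action of `c` to
the differentials. -/
def functor (h : IsTwist D D' c) : DGMod.{u, v, w} D ⥤ DGMod.{u, v, w} D' where
  obj M := h.mod M
  map {M N} f :=
    { lin := f.lin
      lin_mem := f.lin_mem
      lin_act := f.lin_act
      lin_d := fun (m : M.carrier) => by
        change f.lin (M.d m + M.act c m) = N.d (f.lin m) + N.act c (f.lin m)
        rw [map_add, f.lin_d, f.lin_act] }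

/-- Twisting by `c` and then by `-c` is the identity. -/
def unitIso (h : IsTwist D D' c) : 𝟭 (DGMod.{u, v, w} D) ≅ h.functor ⋙ h.symm.functor :=
  NatIso.ofComponents (fun M => DGMod.isoMk (M := M) (N := h.symm.mod (h.mod M))
    (LinearEquiv.refl k M.carrier) (fun _ _ => Iff.rfl) (fun _ _ => rfl) (fun (m : M.carrier) => by
      change M.d m = M.d m + M.act c m + M.act (-c) m
      rw [map_neg, LinearMap.neg_apply, add_neg_cancel_right])) (fun _ => rfl)

/-- Twisting by `-c` and then by `c` is the identity. -/
def counitIso (h : IsTwist D D' c) : h.symm.functor ⋙ h.functor ≅ 𝟭 (DGMod.{u, v, w} D') :=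
  NatIso.ofComponents (fun M => DGMod.isoMk (M := h.mod (h.symm.mod M)) (N := M)
    (LinearEquiv.refl k M.carrier) (fun _ _ => Iff.rfl) (fun _ _ => rfl) (fun (m : M.carrier) => by
      change M.d m + M.act (-c) m + M.act c m = M.d m
      rw [map_neg, LinearMap.neg_apply, neg_add_cancel_right])) (fun _ => rfl)

/-! ### Compatibility with shifts, cones, direct sums, totalizations and homotopies -/

/-- The sign `(-1) ^ n` is also the one by which the differential of `M[n]` is multiplied. So `d +
c` on `M` becomes `(-1) ^ n (d + c)` on the shift, whether the twist or the shift comes first. -/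
lemma signAut_of_mem_one (n : ℤ) {c : A} (hc : c ∈ 𝒜 1) :
    signAut 𝒜 n c = n.negOnePow • c := by
  rw [signAut_of_mem 𝒜 n hc, mul_one]

/-- Twisting commutes with the shifts. -/
noncomputable def shiftIso (h : IsTwist D D' c) (M : DGMod.{u, v, w} D) (n : ℤ) :
    h.mod (M.shift n) ≅ (h.mod M).shift n :=
  DGMod.isoMk (M := h.mod (M.shift n)) (N := (h.mod M).shift n) (LinearEquiv.refl k M.carrier)
    (fun _ _ => Iff.rfl) (fun _ _ => rfl) (fun (m : M.carrier) => by
      change n.negOnePow • M.d m + M.act (signAut 𝒜 n c) m = n.negOnePow • (M.d m + M.act c m)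
      rw [signAut_of_mem_one n h.mem, DGMod.act_negOnePow_smul, smul_add])

/-- The comparison maps are identities on the underlying spaces, hence coherent by `rfl`. -/
noncomputable instance (h : IsTwist D D' c) : h.functor.{u, v, w}.CommShift ℤ where
  commShiftIso n := NatIso.ofComponents (fun M => h.shiftIso M n) (fun _ => rfl)
  commShiftIso_zero := by ext M m; rfl
  commShiftIso_add n m := by ext M y; rfl

/-- Twisting commutes with cones. -/
noncomputable def coneIso (h : IsTwist D D' c) {M N : DGMod.{u, v, w} D} (f : M ⟶ N) :
    h.mod (DGMod.cone f) ≅ DGMod.cone (h.functor.map f) :=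
  DGMod.isoMk (M := h.mod (DGMod.cone f)) (N := DGMod.cone (h.functor.map f))
    (LinearEquiv.refl k (M.carrier × N.carrier))
    (fun _ _ => Iff.rfl) (fun _ _ => rfl) (fun (m : M.carrier × N.carrier) => by
      refine Prod.ext ?_ ?_
      -- On the summand `M[1]` both `d` and `c` carry the sign `-1`.
      · change -M.d m.1 + M.act (signAut 𝒜 1 c) m.1 = -(M.d m.1 + M.act c m.1)
        rw [signAut_of_mem_one 1 h.mem, DGMod.act_negOnePow_smul, Int.negOnePow_one,
          Units.neg_smul, one_smul, neg_add]
      · exact add_assoc (f.lin m.1) (N.d m.2) (N.act c m.2))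

/-- Twisting commutes with totalizations. -/
noncomputable def totalizationIso (h : IsTwist D D' c) {K L M : DGMod.{u, v, w} D} (f : K ⟶ L)
    (g : L ⟶ M) (hfg : ∀ x, g.lin (f.lin x) = 0) :
    h.mod (DGMod.totalization f g hfg) ≅
      DGMod.totalization (h.functor.map f) (h.functor.map g) hfg :=
  DGMod.isoMk (M := h.mod (DGMod.totalization f g hfg))
    (N := DGMod.totalization (h.functor.map f) (h.functor.map g) hfg)
    (LinearEquiv.refl k (K.carrier × L.carrier × M.carrier))
    (fun _ _ => Iff.rfl) (fun _ _ => rfl) (fun (m : K.carrier × L.carrier × M.carrier) => by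
      refine Prod.ext ?_ (Prod.ext ?_ ?_)
      · change -K.d m.1 + K.act (signAut 𝒜 1 c) m.1 = -(K.d m.1 + K.act c m.1)
        rw [signAut_of_mem_one 1 h.mem, DGMod.act_negOnePow_smul, Int.negOnePow_one,
          Units.neg_smul, one_smul, neg_add]
      · exact add_assoc (f.lin m.1) (L.d m.2.1) (L.act c m.2.1)
      -- The summand `M[-1]` has the same signs as `M[1]`, since `-1` and `1` have the same parity.
      · change g.lin m.2.1 - M.d m.2.2 + M.act (signAut 𝒜 1 c) m.2.2 =
          g.lin m.2.1 - (M.d m.2.2 + M.act c m.2.2)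
        rw [signAut_of_mem_one 1 h.mem, DGMod.act_negOnePow_smul, Int.negOnePow_one,
          Units.neg_smul, one_smul]
        abel)

/-- Twisting commutes with direct sums. -/
noncomputable def directSumIso (h : IsTwist D D' c) {ι : Type w} (M : ι → DGMod.{u, v, w} D) :
    h.mod (DGMod.directSum M) ≅ DGMod.directSum fun i => h.mod (M i) :=
  DGMod.isoMk (M := h.mod (DGMod.directSum M)) (N := DGMod.directSum fun i => h.mod (M i))
    (LinearEquiv.refl k (DirectSum ι fun i => (M i).carrier))
    (fun _ _ => Iff.rfl) (fun _ _ => rfl) (fun _ => DFinsupp.ext fun _ => rfl)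

/-- The same `s` works: it anticommutes with the odd element `c`, so the extra terms `c s + s c`
vanish. -/
lemma homotopic (h : IsTwist D D' c) {M N : DGMod.{u, v, w} D} {f g : M ⟶ N}
    (hfg : DGMod.Homotopic f g) : DGMod.Homotopic (h.functor.map f) (h.functor.map g) := by
  obtain ⟨s, h1, h2, h3⟩ := hfg
  refine ⟨s, h1, h2, fun (m : M.carrier) => ?_⟩
  change f.lin m - g.lin m = N.d (s m) + N.act c (s m) + s (M.d m + M.act c m)
  rw [h3, map_add, h2 m h.mem, Int.negOnePow_one, Units.neg_smul, one_smul]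
  abel

lemma isExactTriple (h : IsTwist D D' c) {K L M : DGMod.{u, v, w} D} {f : K ⟶ L} {g : L ⟶ M}
    (hfg : DGMod.IsExactTriple f g) :
    DGMod.IsExactTriple (h.functor.map f) (h.functor.map g) :=
  ⟨hfg.injective, hfg.exact, hfg.surjective⟩

/-- Twisting commutes with the formation of standard triangles. -/
noncomputable def coneTriangleIso (h : IsTwist D D' c) {M N : DGMod.{u, v, w} D} (f : M ⟶ N) :
    h.functor.mapTriangle.obj (DGMod.coneTriangle f) ≅
      DGMod.coneTriangle (h.functor.map f) :=
  -- All comparison maps, including that with the shift in the third square, are identities on the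
  -- underlying spaces.
  Pretriangulated.Triangle.isoMk _ _ (Iso.refl _) (Iso.refl _) (h.coneIso f) rfl rfl rfl

/-! ### Homotopy categories -/

/-- The functor induced by twisting on the homotopy categories. -/
noncomputable abbrev hoFunctor (h : IsTwist D D' c) : Ho.{u, v, w} D ⥤ Ho.{u, v, w} D' :=
  CategoryTheory.Quotient.lift (DGMod.homotopyRel.{u, v, w} D) (h.functor ⋙ Ho.functor D')
    fun _ _ _ _ hfg => CategoryTheory.Quotient.sound _ (h.homotopic hfg)

/-- The functor `hoFunctor` is induced by `functor`. -/
noncomputable abbrev hoIso (h : IsTwist D D' c) :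
    Ho.functor.{u, v, w} D ⋙ h.hoFunctor ≅ h.functor ⋙ Ho.functor.{u, v, w} D' :=
  CategoryTheory.Quotient.lift.isLift _ _ _

/-- The equivalence of homotopy categories induced by twisting. -/
noncomputable def hoEquivalence (h : IsTwist D D' c) : Ho.{u, v, w} D ≌ Ho.{u, v, w} D' :=
  CategoryTheory.Equivalence.mk h.hoFunctor h.symm.hoFunctor
    (CategoryTheory.Quotient.natIsoLift _ (Functor.isoWhiskerRight h.unitIso (Ho.functor D)))
    (CategoryTheory.Quotient.natIsoLift _ (Functor.isoWhiskerRight h.counitIso (Ho.functor D')))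

instance (h : IsTwist D D' c) : h.hoFunctor.{u, v, w}.IsEquivalence :=
  h.hoEquivalence.isEquivalence_functor

/-- Each closure property is that of `P`, transported along the isomorphism by which twisting
commutes with the construction in question. -/
lemma isAdmissible_inverseImage (h : IsTwist D D' c) {P : ObjectProperty (Ho.{u, v, w} D')}
    (hP : IsAdmissible D' P) : IsAdmissible D (P.inverseImage h.hoFunctor) where
  of_iso e hX := hP.of_iso (h.hoFunctor.mapIso e) hX
  shift M n hM := hP.of_iso ((Ho.functor D').mapIso (h.shiftIso M n).symm) (hP.shift _ n hM)
  cone f hM hN := hP.of_iso ((Ho.functor D').mapIso (h.coneIso f).symm) (hP.cone _ hM hN)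
  directSum M hM :=
    hP.of_iso ((Ho.functor D').mapIso (h.directSumIso M).symm) (hP.directSum _ hM)
  totalization hfg :=
    hP.of_iso ((Ho.functor D').mapIso (h.totalizationIso _ _ hfg.comp_eq_zero).symm)
      (hP.totalization (h.isExactTriple hfg))

/-- A coacyclic object lies in every admissible subcategory, in particular in the preimage of each
admissible `P` over `D'`. -/
lemma coAcycl_hoFunctor_obj (h : IsTwist D D' c) {X : Ho.{u, v, w} D} (hX : CoAcycl D X) :
    CoAcycl D' (h.hoFunctor.obj X) :=
  fun _ hP => hX _ (h.isAdmissible_inverseImage hP)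

/-- The cone of the twist of a representative `g` is the twist of its cone. -/
lemma coAcyclW_hoFunctor_map (h : IsTwist D D' c) {X Y : Ho.{u, v, w} D} {f : X ⟶ Y}
    (hf : coAcyclW D f) : coAcyclW D' (h.hoFunctor.map f) := by
  obtain ⟨M, N, g, ⟨i⟩, hg⟩ := hf
  exact ⟨_, _, h.functor.map g, ⟨h.hoFunctor.mapArrow.mapIso i⟩,
    (isAdmissible_coAcycl D').of_iso ((Ho.functor D').mapIso (h.coneIso g))
      (h.coAcycl_hoFunctor_obj hg)⟩

/-! ### Coderived categories -/

/-- Twisting, as a morphism of localizers between the homotopy categories. -/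
noncomputable abbrev localizerMorphism (h : IsTwist D D' c) :
    LocalizerMorphism (coAcyclW.{u, v, w} D) (coAcyclW.{u, v, w} D') where
  functor := h.hoFunctor
  map _ _ _ hf := h.coAcyclW_hoFunctor_map hf

instance (h : IsTwist D D' c) : h.localizerMorphism.{u, v, w}.IsLocalizedEquivalence :=
  LocalizerMorphism.IsLocalizedEquivalence.of_equivalence _ fun _ _ f hf =>
    -- It must be checked that every morphism with coacyclic cone over `D'` is, up to isomorphism,
    -- the image of such a morphism over `D`. Twisting it back by `-c` provides one, by the counit.
    ⟨_, _, h.symm.hoFunctor.map f, h.symm.coAcyclW_hoFunctor_map hf,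
      ⟨Arrow.isoOfNatIso h.hoEquivalence.counitIso f⟩⟩

/-- The functor induced by twisting on the coderived categories. -/
noncomputable abbrev dcoFunctor (h : IsTwist D D' c) : Dco.{u, v, w} D ⥤ Dco.{u, v, w} D' :=
  h.localizerMorphism.localizedFunctor (coAcyclW D).Q (coAcyclW D').Q

/-- The standard triangle of `f` goes to that of the twisted `f` by `coneTriangleIso`. The rest
transports this isomorphism from DG-modules through the homotopy category to the localization. -/
lemma dcoFunctor_mapTriangle_mem (h : IsTwist D D' c)
    {T : Pretriangulated.Triangle (Dco.{u, v, w} D)} (hT : T ∈ Dco.distTriangles D) :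
    h.dcoFunctor.mapTriangle.obj T ∈ Dco.distTriangles D' := by
  obtain ⟨M, N, f, ⟨i⟩⟩ := hT
  refine ⟨_, _, h.functor.map f, ⟨h.dcoFunctor.mapTriangle.mapIso i ≪≫ ?_⟩⟩
  let e₁ : h.hoFunctor ⋙ (coAcyclW D').Q ≅ (coAcyclW D).Q ⋙ h.dcoFunctor :=
    (h.localizerMorphism.catCommSq (coAcyclW D).Q (coAcyclW D').Q).iso
  -- An isomorphism of functors induces one of triangles only if it respects the shift comparisons,
  -- because the third map of a triangle ends in a shift.
  have : NatTrans.CommShift e₁.hom ℤ :=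
    LocalizerMorphism.natTransCommShift_hom h.localizerMorphism (coAcyclW D).Q (coAcyclW D').Q _ e₁
  exact (h.dcoFunctor.mapTriangle.mapIso
      ((Functor.mapTriangleCompIso (Ho.functor D) (coAcyclW D).Q).app _)) ≪≫
    ((Functor.mapTriangleCompIso (coAcyclW D).Q h.dcoFunctor).app _).symm ≪≫
    (Functor.mapTriangleIso e₁).symm.app _ ≪≫
    (Functor.mapTriangleCompIso h.hoFunctor (coAcyclW D').Q).app _ ≪≫
    (coAcyclW D').Q.mapTriangle.mapIso
      (((Functor.mapTriangleCompIso (Ho.functor D) h.hoFunctor).app _).symm ≪≫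
        (Functor.mapTriangleIso h.hoIso).app _ ≪≫
        (Functor.mapTriangleCompIso h.functor (Ho.functor D')).app _ ≪≫
        (Ho.functor D').mapTriangle.mapIso (h.coneTriangleIso f)) ≪≫
    ((Functor.mapTriangleCompIso (Ho.functor D') (coAcyclW D').Q).app _).symm

end IsTwist

end Change

end DGCoderived

theorem mainTheorem6 {k : Type u} [Field k] {A : Type v} [Ring A] [Algebra k A]
    (𝒜 : ℤ → Submodule k A) [GradedAlgebra 𝒜] (D : DGCoderived.DGStr 𝒜) (a b : A)
    (ha : D.IsMaurerCartan a) (hb : D.IsMaurerCartan b) :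
    (∃ φ : DGCoderived.CDGHom D.toCDG (D.twist a ha).toCDG,
      φ.f = AlgHom.id k A ∧ φ.c = -a ∧ φ.IsIso) ∧
    (∃ φ : DGCoderived.CDGHom (D.twist a ha).toCDG (D.twist b hb).toCDG,
      φ.f = AlgHom.id k A ∧ φ.c = a - b ∧ φ.IsIso) ∧
    ∃ (e : DGCoderived.Dco.{u, v, w} (D.twist a ha) ≌ DGCoderived.Dco.{u, v, w} (D.twist b hb))
      (_ : e.functor.CommShift ℤ),
      ∀ T ∈ DGCoderived.Dco.distTriangles.{u, v, w} (D.twist a ha),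
        e.functor.mapTriangle.obj T ∈ DGCoderived.Dco.distTriangles.{u, v, w} (D.twist b hb) := by
  have h := DGCoderived.IsTwist.of_twist D ha
  -- The twisting element is `b - a`, so the change of curvature is `-(b - a) = a - b`.
  have h' := DGCoderived.IsTwist.twist_twist D ha hb
  exact ⟨⟨h.cdgHom, rfl, rfl, h.isIso_cdgHom⟩,
    ⟨h'.cdgHom, rfl, neg_sub b a, h'.isIso_cdgHom⟩,
    h'.dcoFunctor.asEquivalence, (inferInstance : h'.dcoFunctor.CommShift ℤ),
    fun _ hT => h'.dcoFunctor_mapTriangle_mem hT⟩
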